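/- Let $\mathcal M$ be one of the following four classes of probability distributions $F$ on $\mathbb R$ (where $\mu(F)=\int x\,dF(x)$ denotes the mean): $\mathcal B$, the distributions with bounded support; $\mathcal{SG}$, the sub-Gaussian distributions, i.e. those for which there is $\sigma>0$ with $\int e^{\lambda(x-\mu(F))}\,dF(x)\le e^{\sigma^2\lambda^2/2}$ for all $\lambda\in\mathbb R$; $\mathcal{SE}$, the sub-exponential distributions, i.e. those for which there are $v,\alpha>0$ with $\int e^{\lambda(x-\mu(F))}\,dF(x)\le e^{v^2\lambda^2/2}$ for all $|\lambda|<1/\alpha$; $\mathcal G$, the distributions with $\int |x|^{1+\varepsilon}\,dF(x)<\infty$ for some $\varepsilon>0$. Consider the stochastic bandit problem with $k$ arms. An instance is a tuple $\nu=(\nu_1,\dots,\nu_k)\in\mathcal M^k$ of reward distributions. A policy $\pi$ chooses in each round an arm, possibly at random, with a distribution that depends measurably on the arms pulled and the rewards received in the earlier rounds; it then receives a reward drawn from the distribution of the chosen arm, independently of the past given that arm. Let $T_i(n)$ be the number of pulls of arm $i$ in the first $n$ rounds, $\Delta_i=\max_{j}\mu(\nu_j)-\mu(\nu_i)$, and let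 $$R_n(\pi,\nu)=\sum_{i=1}^k\Delta_i\,\mathbb E[T_i(n)]$$ be the regret. The policy $\pi$ is called consistent over $\mathcal M^k$ if, for every $\nu\in\mathcal M^k$ and every $a>0$, $R_n(\pi,\nu)=o(n^a)$ as $n\to\infty$. Then for every policy $\pi$ that is consistent over $\mathcal M^k$, and every instance $\nu\in\mathcal M^k$ that has at least one suboptimal arm (i.e. $\Delta_i>0$ for some $i$), $$\lim_{n\to\infty}\frac{R_n(\pi,\nu)}{\log n}=\infty .$$ -/

import Mathlib

open MeasureTheory ProbabilityTheory Filter Asymptotics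
open scoped Topology NNReal

noncomputable section

namespace Bandit

/-! ### Classes of reward distributions -/

/-- The mean of a distribution on the real line. -/
def mean (F : ProbabilityMeasure ℝ) : ℝ := ∫ x, x ∂(F : Measure ℝ)

/-- Distributions whose support is contained in `[a, b]`. -/
def boundedOn (a b : ℝ) : Set (ProbabilityMeasure ℝ) :=
  {F | (F : Measure ℝ) (Set.Icc a b)ᶜ = 0}

/-- All bounded distributions. -/
def bounded : Set (ProbabilityMeasure ℝ) := {F | ∃ a b : ℝ, F ∈ boundedOn a b}

/-- `σ`-sub-Gaussian distributions: `∫ exp (l (x - mean F)) dF ≤ exp (σ² l² / 2)` for every real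
`l`, the exponential being integrable. -/
def subGaussianWith (σ : ℝ) : Set (ProbabilityMeasure ℝ) :=
  {F | ∀ l : ℝ, Integrable (fun x : ℝ => Real.exp (l * (x - mean F))) (F : Measure ℝ) ∧
    ∫ x, Real.exp (l * (x - mean F)) ∂(F : Measure ℝ) ≤ Real.exp (σ ^ 2 * l ^ 2 / 2)}

/-- All sub-Gaussian distributions. -/
def subGaussian : Set (ProbabilityMeasure ℝ) := {F | ∃ σ : ℝ, 0 < σ ∧ F ∈ subGaussianWith σ}

/-- Sub-exponential distributions with parameters `v`, `α`:
`∫ exp (l (x - mean F)) dF ≤ exp (v² l² / 2)` for `|l| < 1 / α`, the exponential being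
integrable. -/
def subExponentialWith (v α : ℝ) : Set (ProbabilityMeasure ℝ) :=
  {F | ∀ l : ℝ, |l| < 1 / α →
    Integrable (fun x : ℝ => Real.exp (l * (x - mean F))) (F : Measure ℝ) ∧
    ∫ x, Real.exp (l * (x - mean F)) ∂(F : Measure ℝ) ≤ Real.exp (v ^ 2 * l ^ 2 / 2)}

/-- All sub-exponential distributions. -/
def subExponential : Set (ProbabilityMeasure ℝ) :=
  {F | ∃ v α : ℝ, 0 < v ∧ 0 < α ∧ F ∈ subExponentialWith v α}

/-- Distributions whose absolute moment of order `1 + ε` is at most `C`. -/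
def momentBoundedBy (ε C : ℝ) : Set (ProbabilityMeasure ℝ) :=
  {F | Integrable (fun x : ℝ => |x| ^ (1 + ε)) (F : Measure ℝ) ∧
    ∫ x, |x| ^ (1 + ε) ∂(F : Measure ℝ) ≤ C}

/-- All distributions with a finite absolute moment of order `1 + ε` for some `ε > 0`. -/
def finiteMoment : Set (ProbabilityMeasure ℝ) :=
  {F | ∃ ε C : ℝ, 0 < ε ∧ 0 < C ∧ F ∈ momentBoundedBy ε C}

/-! ### Policies and their interaction with an instance -/

/-- The history of `n` rounds with `k` arms: the arm pulled and the reward received, round by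
round. -/
abbrev History (k n : ℕ) : Type := Fin n → Fin k × ℝ

/-- A (possibly randomized) policy: after any history of `t` rounds it prescribes, measurably in
the history, the distribution of the next arm. -/
structure Policy (k : ℕ) where
  /-- The conditional distribution of the next arm given the history of the first `t` rounds. -/
  next : (t : ℕ) → Kernel (History k t) (Fin k)
  isMarkov : ∀ t, IsMarkovKernel (next t)

instance {k : ℕ} (π : Policy k) (t : ℕ) : IsMarkovKernel (π.next t) := π.isMarkov t

/-- The kernel sending an arm to its reward distribution. -/
def rewardKernel {k : ℕ} (ν : Fin k → ProbabilityMeasure ℝ) : Kernel (Fin k) ℝ where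
  toFun i := (ν i : Measure ℝ)
  measurable' := measurable_of_countable _

instance {k : ℕ} (ν : Fin k → ProbabilityMeasure ℝ) : IsMarkovKernel (rewardKernel ν) :=
  ⟨fun i => inferInstanceAs (IsProbabilityMeasure (ν i : Measure ℝ))⟩

/-- One round: given the history, draw an arm from the policy, then a reward from that arm. -/
def roundKernel {k : ℕ} (π : Policy k) (ν : Fin k → ProbabilityMeasure ℝ) (t : ℕ) :
    Kernel (History k t) (Fin k × ℝ) :=
  (π.next t) ⊗ₖ (Kernel.prodMkLeft (History k t) (rewardKernel ν))

instance {k : ℕ} (π : Policy k) (ν : Fin k → ProbabilityMeasure ℝ) (t : ℕ) :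
    IsMarkovKernel (roundKernel π ν t) := by
  unfold roundKernel; infer_instance

/-- Append the outcome of one more round to a history. -/
def extend {k n : ℕ} (p : History k n × (Fin k × ℝ)) : History k (n + 1) :=
  Fin.snoc (α := fun _ => Fin k × ℝ) p.1 p.2

theorem measurable_extend {k n : ℕ} : Measurable (extend (k := k) (n := n)) := by
  refine measurable_pi_iff.2 fun t => ?_
  refine Fin.lastCases ?_ (fun j => ?_) t
  · simpa [extend] using measurable_snd
  · simp only [extend, Fin.snoc_castSucc]
    exact (measurable_pi_apply j).comp measurable_fst

/-- The law of the history of the first `n` rounds when the policy `π` plays on the instance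
`ν`. -/
def historyLaw {k : ℕ} (π : Policy k) (ν : Fin k → ProbabilityMeasure ℝ) :
    (n : ℕ) → Measure (History k n)
  | 0 => Measure.dirac Fin.elim0
  | n + 1 => ((historyLaw π ν n) ⊗ₘ (roundKernel π ν n)).map extend

instance isProbabilityMeasure_historyLaw {k : ℕ} (π : Policy k)
    (ν : Fin k → ProbabilityMeasure ℝ) (n : ℕ) : IsProbabilityMeasure (historyLaw π ν n) := by
  induction n with
  | zero => unfold historyLaw; infer_instance
  | succ n ih =>
    unfold historyLaw
    exact Measure.isProbabilityMeasure_map measurable_extend.aemeasurable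

/-- The number of pulls of arm `i` in a history. -/
def pulls {k n : ℕ} (i : Fin k) (h : History k n) : ℕ :=
  (Finset.univ.filter fun t : Fin n => (h t).1 = i).card

/-- The expected number of pulls of arm `i` in the first `n` rounds. -/
def expectedPulls {k : ℕ} (π : Policy k) (ν : Fin k → ProbabilityMeasure ℝ) (i : Fin k)
    (n : ℕ) : ℝ :=
  ∫ h, (pulls i h : ℝ) ∂(historyLaw π ν n)

/-- The sub-optimality gap of arm `i`: the largest mean minus the mean of arm `i`. -/
def gap {k : ℕ} (ν : Fin k → ProbabilityMeasure ℝ) (i : Fin k) : ℝ :=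
  (⨆ j, mean (ν j)) - mean (ν i)

/-- The regret of the policy `π` on the instance `ν` after `n` rounds. -/
def regret {k : ℕ} (π : Policy k) (ν : Fin k → ProbabilityMeasure ℝ) (n : ℕ) : ℝ :=
  ∑ i, gap ν i * expectedPulls π ν i n

/-- A policy is consistent over `M ^ k` if its regret is `o(n ^ a)` for every `a > 0`, on every
instance whose arms all lie in `M`. -/
def Consistent {k : ℕ} (M : Set (ProbabilityMeasure ℝ)) (π : Policy k) : Prop :=
  ∀ ν : Fin k → ProbabilityMeasure ℝ, (∀ i, ν i ∈ M) → ∀ a : ℝ, 0 < a →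
    (fun n : ℕ => regret π ν n) =o[atTop] (fun n : ℕ => (n : ℝ) ^ a)

end Bandit

end

namespace Bandit

/-! Each class is closed under mixing with a point mass at an arbitrary point `y`. If the mass has
weight `1 - exp (-δ)`, then `F` is at most `exp δ` times the mixture, whatever `y` is, and a distant
`y` lifts the mean as high as desired. So a suboptimal arm can be made the best one at arbitrarily
small information cost, and no finite multiple of `log n` can bound the regret.

Quantitatively, suppose the regret on `ν` is below `K log n` for some large `n`. By Markov's
inequality a suboptimal arm `i` is pulled at most `B log n` times with probability at least `1 / 2`,
where `B = 2 K / gap ν i`. Let `ν'` differ from `ν` only in arm `i`, now best by at least one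
(`exists_perturbation`). The likelihood ratio on that event is at most `n ^ (δ B)`
(`lintegral_historyLaw_le`, `measureReal_pulls_le_le`). With `δ B = 1 / 4` the event keeps
probability at least `n ^ (-1 / 4) / 2` under `ν'`, and on it at least `n / 2` rounds each cost at
least one. The regret on `ν'` is then at least `n ^ (3 / 4) / 4`, against consistency. -/

/-- The mixture of `F` with a point mass of weight `p` at `y`. -/
noncomputable def mixDirac (F : ProbabilityMeasure ℝ) (p : ℝ) (hp : p ∈ Set.Icc (0 : ℝ) 1)
    (y : ℝ) : ProbabilityMeasure ℝ :=
  ⟨ENNReal.ofReal (1 - p) • (F : Measure ℝ) + ENNReal.ofReal p • Measure.dirac y, ⟨by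
    simp only [Measure.coe_add, Measure.coe_smul, Pi.add_apply, Pi.smul_apply, measure_univ,
      smul_eq_mul, mul_one]
    rw [← ENNReal.ofReal_add (by linarith [hp.2]) hp.1]
    simp⟩⟩

theorem toMeasure_mixDirac (F : ProbabilityMeasure ℝ) (p : ℝ) (hp : p ∈ Set.Icc (0 : ℝ) 1)
    (y : ℝ) : (mixDirac F p hp y : Measure ℝ) =
      ENNReal.ofReal (1 - p) • (F : Measure ℝ) + ENNReal.ofReal p • Measure.dirac y := rfl

/-- Discarding the atom costs only the factor `1 - p`. The bound is independent of `y`, so the atom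
can be moved away freely. -/
theorem le_smul_mixDirac (F : ProbabilityMeasure ℝ) (p : ℝ) (hp : p ∈ Set.Icc (0 : ℝ) 1)
    (y c : ℝ) (hc : c * (1 - p) = 1) :
    (F : Measure ℝ) ≤ ENNReal.ofReal c • (mixDirac F p hp y : Measure ℝ) := by
  have hc' : ENNReal.ofReal c * ENNReal.ofReal (1 - p) = 1 := by
    rw [← ENNReal.ofReal_mul' (by linarith [hp.2]), hc, ENNReal.ofReal_one]
  rw [toMeasure_mixDirac, smul_add, smul_smul, hc', one_smul]
  exact Measure.le_add_right le_rfl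

theorem integrable_mixDirac {F : ProbabilityMeasure ℝ} {p : ℝ} (hp : p ∈ Set.Icc (0 : ℝ) 1)
    (y : ℝ) {f : ℝ → ℝ} (hf : Integrable f (F : Measure ℝ)) :
    Integrable f (mixDirac F p hp y : Measure ℝ) := by
  rw [toMeasure_mixDirac]
  exact (hf.smul_measure ENNReal.ofReal_ne_top).add_measure
    ((integrable_dirac (by simp)).smul_measure ENNReal.ofReal_ne_top)

theorem integral_mixDirac {F : ProbabilityMeasure ℝ} {p : ℝ} (hp : p ∈ Set.Icc (0 : ℝ) 1)
    (y : ℝ) {f : ℝ → ℝ} (hf : Integrable f (F : Measure ℝ)) :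
    ∫ x, f x ∂(mixDirac F p hp y : Measure ℝ) =
      (1 - p) * ∫ x, f x ∂(F : Measure ℝ) + p * f y := by
  rw [toMeasure_mixDirac, integral_add_measure (hf.smul_measure ENNReal.ofReal_ne_top)
    ((integrable_dirac (by simp)).smul_measure ENNReal.ofReal_ne_top), integral_smul_measure,
    integral_smul_measure, integral_dirac, ENNReal.toReal_ofReal (by linarith [hp.2]),
    ENNReal.toReal_ofReal hp.1, smul_eq_mul, smul_eq_mul]

theorem mean_mixDirac {F : ProbabilityMeasure ℝ} {p : ℝ} (hp : p ∈ Set.Icc (0 : ℝ) 1)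
    (y : ℝ) (hF : Integrable (fun x => x) (F : Measure ℝ)) :
    mean (mixDirac F p hp y) = (1 - p) * mean F + p * y :=
  integral_mixDirac hp y hF

/-! ### Integrability and stability of the four classes -/

theorem integrable_id_of_mem_bounded {F : ProbabilityMeasure ℝ} (hF : F ∈ bounded) :
    Integrable (fun x => x) (F : Measure ℝ) := by
  obtain ⟨a, b, h⟩ := hF
  refine Integrable.of_bound (by fun_prop) (max |a| |b|) ?_
  have h' : ∀ᵐ x ∂(F : Measure ℝ), x ∈ Set.Icc a b := h
  filter_upwards [h'] with x hx
  exact abs_le_max_abs_abs hx.1 hx.2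

/-- By `t + 1 ≤ exp t`, `|t|` is at most `exp t + exp (-t)`. Integrability is needed because `mean`
takes the default value `0` otherwise. -/
theorem integrable_id_of_integrable_exp {F : ProbabilityMeasure ℝ} {m l : ℝ} (hl : 0 < l)
    (h₁ : Integrable (fun x : ℝ => Real.exp (l * (x - m))) (F : Measure ℝ))
    (h₂ : Integrable (fun x : ℝ => Real.exp (-l * (x - m))) (F : Measure ℝ)) :
    Integrable (fun x => x) (F : Measure ℝ) := by
  have h : Integrable (fun x : ℝ => l * (x - m)) (F : Measure ℝ) := by
    refine (h₁.add h₂).mono' (by fun_prop) (ae_of_all _ fun x => ?_)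
    rw [Real.norm_eq_abs, Pi.add_apply, abs_le]
    constructor
    · linarith [Real.add_one_le_exp (-l * (x - m)), Real.exp_pos (l * (x - m))]
    · linarith [Real.add_one_le_exp (l * (x - m)), Real.exp_pos (-l * (x - m))]
  refine ((h.const_mul l⁻¹).add (integrable_const m)).congr (ae_of_all _ fun x => ?_)
  simp only [Pi.add_apply]
  field_simp
  ring

theorem integrable_id_of_mem_subExponential {F : ProbabilityMeasure ℝ}
    (hF : F ∈ subExponential) : Integrable (fun x => x) (F : Measure ℝ) := by
  obtain ⟨v, α, -, hα, h⟩ := hF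
  have hl : |1 / α / 2| < 1 / α := by
    rw [abs_of_pos (by positivity)]
    exact half_lt_self (by positivity)
  exact integrable_id_of_integrable_exp (l := 1 / α / 2) (by positivity) (h _ hl).1
    (h _ (by rwa [abs_neg])).1

theorem integrable_id_of_mem_subGaussian {F : ProbabilityMeasure ℝ}
    (hF : F ∈ subGaussian) : Integrable (fun x => x) (F : Measure ℝ) := by
  obtain ⟨σ, -, h⟩ := hF
  exact integrable_id_of_integrable_exp one_pos (h _).1 (h _).1

theorem integrable_id_of_mem_finiteMoment {F : ProbabilityMeasure ℝ}
    (hF : F ∈ finiteMoment) : Integrable (fun x => x) (F : Measure ℝ) := by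
  obtain ⟨ε, C, hε, -, h, -⟩ := hF
  refine ((integrable_const (1 : ℝ)).add h).mono' (by fun_prop) (ae_of_all _ fun x => ?_)
  rw [Real.norm_eq_abs, Pi.add_apply]
  rcases le_total |x| 1 with hx | hx
  · have := Real.rpow_nonneg (abs_nonneg x) (1 + ε)
    linarith
  · have := Real.rpow_le_rpow_of_exponent_le hx (show (1 : ℝ) ≤ 1 + ε by linarith)
    rw [Real.rpow_one] at this
    linarith

/-- The centred two-point law with weights `1 - p` at `a` and `p` at `b` satisfies Hoeffding's
bound. -/
theorem twoPoint_exp_le {p : ℝ} (hp : p ∈ Set.Icc (0 : ℝ) 1) (a b l : ℝ) :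
    (1 - p) * Real.exp (l * (a - ((1 - p) * a + p * b))) +
      p * Real.exp (l * (b - ((1 - p) * a + p * b))) ≤ Real.exp ((b - a) ^ 2 * l ^ 2 / 8) := by
  obtain ⟨D, hD⟩ : ∃ D : ProbabilityMeasure ℝ, (D : Measure ℝ) = Measure.dirac a :=
    ⟨⟨Measure.dirac a, inferInstance⟩, rfl⟩
  let F : ProbabilityMeasure ℝ := mixDirac D p hp b
  have hint : ∀ f : ℝ → ℝ, ∫ x, f x ∂(F : Measure ℝ) = (1 - p) * f a + p * f b := fun f => by
    have h := integral_mixDirac (F := D) hp b (f := f) (hD ▸ integrable_dirac (by simp))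
    rw [hD, integral_dirac] at h
    exact h
  have hmem : ∀ᵐ x ∂(F : Measure ℝ), x ∈ Set.Icc (min a b) (max a b) := by
    change ∀ᵐ x ∂(mixDirac D p hp b : Measure ℝ), _
    rw [toMeasure_mixDirac, ae_add_measure_iff]
    constructor
    · refine Measure.ae_smul_measure ?_ _
      rw [hD, ae_dirac_eq]
      simp
    · refine Measure.ae_smul_measure ?_ _
      rw [ae_dirac_eq]
      simp
  have h := (hasSubgaussianMGF_of_mem_Icc (X := fun x : ℝ => x) (μ := (F : Measure ℝ))
    (by fun_prop) hmem).mgf_le l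
  rw [mgf, hint, hint] at h
  refine h.trans (Real.exp_le_exp.2 (le_of_eq ?_))
  have : (((‖max a b - min a b‖₊ / 2) ^ 2 : ℝ≥0) : ℝ) = (b - a) ^ 2 / 4 := by
    push_cast
    rw [max_sub_min_eq_abs, Real.norm_eq_abs, abs_abs, div_pow, sq_abs]
    norm_num
  rw [this]
  ring

/-- The mixture is a two-point law on `mean F` and `y`, with the centred noise of `F` added in the
first branch, so the variance proxies add up. The argument works for each `l` separately and thus
serves both exponential classes. -/
theorem integral_exp_mixDirac_le {F : ProbabilityMeasure ℝ} {p : ℝ}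
    (hp : p ∈ Set.Icc (0 : ℝ) 1) (y : ℝ) (hF : Integrable (fun x => x) (F : Measure ℝ))
    {σ l : ℝ} (hi : Integrable (fun x : ℝ => Real.exp (l * (x - mean F))) (F : Measure ℝ))
    (h : ∫ x, Real.exp (l * (x - mean F)) ∂(F : Measure ℝ) ≤ Real.exp (σ ^ 2 * l ^ 2 / 2)) :
    Integrable (fun x : ℝ => Real.exp (l * (x - mean (mixDirac F p hp y))))
      (mixDirac F p hp y : Measure ℝ) ∧
    ∫ x, Real.exp (l * (x - mean (mixDirac F p hp y))) ∂(mixDirac F p hp y : Measure ℝ) ≤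
      Real.exp (√(σ ^ 2 + (y - mean F) ^ 2 / 4) ^ 2 * l ^ 2 / 2) := by
  set m := mean (mixDirac F p hp y) with hm
  have hfun : (fun x : ℝ => Real.exp (l * (x - m))) =
      fun x => Real.exp (l * (mean F - m)) * Real.exp (l * (x - mean F)) := by
    funext x
    rw [← Real.exp_add]
    ring_nf
  have hi' : Integrable (fun x : ℝ => Real.exp (l * (x - m))) (F : Measure ℝ) := by
    rw [hfun]
    exact hi.const_mul _
  refine ⟨integrable_mixDirac hp y hi', ?_⟩
  rw [integral_mixDirac hp y hi']
  have h₁ : ∫ x, Real.exp (l * (x - m)) ∂(F : Measure ℝ) ≤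
      Real.exp (l * (mean F - m)) * Real.exp (σ ^ 2 * l ^ 2 / 2) := by
    rw [hfun, integral_const_mul]
    gcongr
  -- The atom carries no noise; the extra factor, at least one, lets the noise bound be pulled out
  -- of both branches.
  have h₂ : Real.exp (l * (y - m)) ≤
      Real.exp (l * (y - m)) * Real.exp (σ ^ 2 * l ^ 2 / 2) :=
    le_mul_of_one_le_right (Real.exp_pos _).le (Real.one_le_exp (by positivity))
  have h₃ := twoPoint_exp_le hp (mean F) y l
  rw [← mean_mixDirac hp y hF, ← hm] at h₃
  have hp₀ := hp.1
  have hp₁ : 0 ≤ 1 - p := by linarith [hp.2]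
  calc (1 - p) * ∫ x, Real.exp (l * (x - m)) ∂(F : Measure ℝ) + p * Real.exp (l * (y - m))
      ≤ (1 - p) * (Real.exp (l * (mean F - m)) * Real.exp (σ ^ 2 * l ^ 2 / 2)) +
          p * (Real.exp (l * (y - m)) * Real.exp (σ ^ 2 * l ^ 2 / 2)) := by gcongr
    _ = ((1 - p) * Real.exp (l * (mean F - m)) + p * Real.exp (l * (y - m))) *
          Real.exp (σ ^ 2 * l ^ 2 / 2) := by ring
    _ ≤ Real.exp ((y - mean F) ^ 2 * l ^ 2 / 8) * Real.exp (σ ^ 2 * l ^ 2 / 2) := by gcongr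
    _ = _ := by
      rw [← Real.exp_add, Real.sq_sqrt (by positivity)]
      ring_nf

theorem mixDirac_mem_bounded {F : ProbabilityMeasure ℝ} (hF : F ∈ bounded) {p : ℝ}
    (hp : p ∈ Set.Icc (0 : ℝ) 1) (y : ℝ) : mixDirac F p hp y ∈ bounded := by
  obtain ⟨a, b, h⟩ := hF
  have h' : ∀ᵐ x ∂(F : Measure ℝ), x ∈ Set.Icc a b := h
  refine ⟨min a y, max b y, ?_⟩
  change ∀ᵐ x ∂(mixDirac F p hp y : Measure ℝ), x ∈ Set.Icc (min a y) (max b y)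
  rw [toMeasure_mixDirac, ae_add_measure_iff]
  constructor
  · refine Measure.ae_smul_measure ?_ _
    filter_upwards [h'] with x hx
    exact ⟨(min_le_left _ _).trans hx.1, hx.2.trans (le_max_left _ _)⟩
  · refine Measure.ae_smul_measure ?_ _
    rw [ae_dirac_eq]
    simp

theorem mixDirac_mem_subGaussian {F : ProbabilityMeasure ℝ} (hF : F ∈ subGaussian) {p : ℝ}
    (hp : p ∈ Set.Icc (0 : ℝ) 1) (y : ℝ) : mixDirac F p hp y ∈ subGaussian := by
  have hint := integrable_id_of_mem_subGaussian hF
  obtain ⟨σ, hσ, h⟩ := hF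
  exact ⟨√(σ ^ 2 + (y - mean F) ^ 2 / 4), by positivity,
    fun l => integral_exp_mixDirac_le hp y hint (h l).1 (h l).2⟩

theorem mixDirac_mem_subExponential {F : ProbabilityMeasure ℝ} (hF : F ∈ subExponential) {p : ℝ}
    (hp : p ∈ Set.Icc (0 : ℝ) 1) (y : ℝ) : mixDirac F p hp y ∈ subExponential := by
  have hint := integrable_id_of_mem_subExponential hF
  obtain ⟨v, α, hv, hα, h⟩ := hF
  exact ⟨√(v ^ 2 + (y - mean F) ^ 2 / 4), α, by positivity, hα,
    fun l hl => integral_exp_mixDirac_le hp y hint (h l hl).1 (h l hl).2⟩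

theorem mixDirac_mem_finiteMoment {F : ProbabilityMeasure ℝ} (hF : F ∈ finiteMoment) {p : ℝ}
    (hp : p ∈ Set.Icc (0 : ℝ) 1) (y : ℝ) : mixDirac F p hp y ∈ finiteMoment := by
  obtain ⟨ε, C, hε, hC, h, -⟩ := hF
  -- The moment bound is the new moment itself, raised to at least `1` for positivity.
  exact ⟨ε, _, hε, lt_of_lt_of_le one_pos (le_max_left _ _), integrable_mixDirac hp y h,
    le_max_right 1 _⟩

/-! ### Pull counts -/

theorem pulls_extend {k n : ℕ} (i : Fin k) (h : History k n) (z : Fin k × ℝ) :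
    pulls i (extend (h, z)) = pulls i h + if z.1 = i then 1 else 0 := by
  rw [pulls, pulls, Finset.card_filter, Finset.card_filter, Fin.sum_univ_castSucc]
  simp [extend]

theorem sum_pulls {k n : ℕ} (h : History k n) : ∑ i, pulls i h = n := by
  have := Finset.card_eq_sum_card_fiberwise (f := fun t : Fin n => (h t).1)
    (s := Finset.univ) (t := Finset.univ) (fun _ _ => Finset.mem_coe.2 (Finset.mem_univ _))
  simpa [pulls] using this.symm

theorem pulls_le {k n : ℕ} (i : Fin k) (h : History k n) : pulls i h ≤ n := by
  simpa [pulls] using (Finset.univ.filter fun t : Fin n => (h t).1 = i).card_le_univ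

theorem measurable_pulls {k n : ℕ} (i : Fin k) :
    Measurable (pulls i : History k n → ℕ) := by
  unfold pulls
  simp only [Finset.card_filter]
  refine Finset.measurable_fun_sum _ fun t _ => Measurable.ite ?_ measurable_const measurable_const
  exact (measurable_fst.comp (measurable_pi_apply t)) (measurableSet_singleton i)

theorem integrable_pulls {k : ℕ} (π : Policy k) (ν : Fin k → ProbabilityMeasure ℝ) (i : Fin k)
    (n : ℕ) : Integrable (fun h => (pulls i h : ℝ)) (historyLaw π ν n) := by
  refine Integrable.of_bound
    (measurable_from_nat.comp (measurable_pulls i)).aestronglyMeasurable n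
    (ae_of_all _ fun h => ?_)
  rw [Real.norm_of_nonneg (Nat.cast_nonneg _)]
  exact_mod_cast pulls_le i h

theorem expectedPulls_nonneg {k : ℕ} (π : Policy k) (ν : Fin k → ProbabilityMeasure ℝ)
    (i : Fin k) (n : ℕ) : 0 ≤ expectedPulls π ν i n :=
  integral_nonneg fun _ => Nat.cast_nonneg _

theorem sum_expectedPulls {k : ℕ} (π : Policy k) (ν : Fin k → ProbabilityMeasure ℝ) (n : ℕ) :
    ∑ i, expectedPulls π ν i n = n := by
  simp only [expectedPulls]
  rw [← integral_finsetSum _ fun i _ => integrable_pulls π ν i n]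
  simp only [← Nat.cast_sum, sum_pulls]
  simp

theorem mean_le_iSup {k : ℕ} (ν : Fin k → ProbabilityMeasure ℝ) (i : Fin k) :
    mean (ν i) ≤ ⨆ j, mean (ν j) :=
  le_ciSup (f := fun j => mean (ν j)) (Set.finite_range _).bddAbove i

theorem gap_nonneg {k : ℕ} (ν : Fin k → ProbabilityMeasure ℝ) (i : Fin k) : 0 ≤ gap ν i :=
  sub_nonneg.2 (mean_le_iSup ν i)

theorem gap_mul_expectedPulls_le_regret {k : ℕ} (π : Policy k)
    (ν : Fin k → ProbabilityMeasure ℝ) (i : Fin k) (n : ℕ) :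
    gap ν i * expectedPulls π ν i n ≤ regret π ν n :=
  Finset.single_le_sum (f := fun i => gap ν i * expectedPulls π ν i n)
    (fun j _ => mul_nonneg (gap_nonneg ν j) (expectedPulls_nonneg π ν j n)) (Finset.mem_univ i)

/-- If every arm but `i` has gap at least one, the regret is at least the expected number of
rounds in which `i` is not pulled. -/
theorem sub_expectedPulls_le_regret {k : ℕ} (π : Policy k)
    (ν : Fin k → ProbabilityMeasure ℝ) (i : Fin k) (hi : ∀ j ≠ i, 1 ≤ gap ν j) (n : ℕ) :
    n - expectedPulls π ν i n ≤ regret π ν n := by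
  rw [← sum_expectedPulls π ν n, ← Finset.sum_erase_eq_sub (Finset.mem_univ i)]
  unfold regret
  rw [← Finset.add_sum_erase _ _ (Finset.mem_univ i)]
  refine le_add_of_nonneg_of_le (mul_nonneg (gap_nonneg ν i) (expectedPulls_nonneg π ν i n))
    (Finset.sum_le_sum fun j hj => ?_)
  exact le_mul_of_one_le_left (expectedPulls_nonneg π ν j n) (hi j (Finset.ne_of_mem_erase hj))

theorem mul_measureReal_le_sub_expectedPulls {k : ℕ} (π : Policy k)
    (ν : Fin k → ProbabilityMeasure ℝ) (i : Fin k) (n : ℕ) (m : ℝ) :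
    (n - m) * (historyLaw π ν n).real {h | (pulls i h : ℝ) ≤ m} ≤
      n - expectedPulls π ν i n := by
  have hint : Integrable (fun h => (n : ℝ) - pulls i h) (historyLaw π ν n) :=
    (integrable_const _).sub (integrable_pulls π ν i n)
  have h := mul_meas_ge_le_integral_of_nonneg (μ := historyLaw π ν n)
    (f := fun h => (n : ℝ) - pulls i h)
    (ae_of_all _ fun h => sub_nonneg.2 (Nat.cast_le.2 (pulls_le i h))) hint (n - m)
  rw [integral_sub (integrable_const _) (integrable_pulls π ν i n)] at h
  simpa only [expectedPulls, sub_le_sub_iff_left, integral_const, probReal_univ, one_smul]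
    using h

theorem half_le_measureReal_pulls_le {k : ℕ} (π : Policy k)
    (ν : Fin k → ProbabilityMeasure ℝ) (i : Fin k) (n : ℕ) {m : ℝ} (hm : 0 < m)
    (h : 2 * expectedPulls π ν i n ≤ m) :
    1 / 2 ≤ (historyLaw π ν n).real {h | (pulls i h : ℝ) ≤ m} := by
  have h₁ := mul_meas_ge_le_integral_of_nonneg (μ := historyLaw π ν n)
    (f := fun h => (pulls i h : ℝ)) (ae_of_all _ fun h => Nat.cast_nonneg _)
    (integrable_pulls π ν i n) m
  have hmeas : MeasurableSet {h : History k n | (pulls i h : ℝ) ≤ m} :=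
    measurableSet_le (measurable_from_nat.comp (measurable_pulls i)) measurable_const
  have h₂ := probReal_compl_eq_one_sub (μ := historyLaw π ν n) hmeas
  -- Markov's inequality controls the non-strict event, which contains the complement.
  have h₃ : (historyLaw π ν n).real {h | (pulls i h : ℝ) ≤ m}ᶜ ≤
      (historyLaw π ν n).real {h | m ≤ (pulls i h : ℝ)} :=
    measureReal_mono fun x hx => (not_le.1 (show ¬(pulls i x : ℝ) ≤ m from hx)).le
  have h₄ : m * (historyLaw π ν n).real {h | m ≤ (pulls i h : ℝ)} ≤ m * (1 / 2) := by
    refine h₁.trans ?_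
    rw [expectedPulls] at h
    linarith
  have := le_of_mul_le_mul_left h₄ hm
  linarith

/-! ### Change of measure -/

theorem lintegral_historyLaw_succ {k : ℕ} (π : Policy k) (ν : Fin k → ProbabilityMeasure ℝ)
    (n : ℕ) {f : History k (n + 1) → ENNReal} (hf : Measurable f) :
    ∫⁻ h, f h ∂historyLaw π ν (n + 1) =
      ∫⁻ h, ∫⁻ a, ∫⁻ x, f (extend (h, (a, x))) ∂(ν a : Measure ℝ) ∂π.next n h
        ∂historyLaw π ν n := by
  have hfe : Measurable fun p : History k n × (Fin k × ℝ) => f (extend p) :=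
    hf.comp measurable_extend
  rw [historyLaw, lintegral_map hf measurable_extend, Measure.lintegral_compProd hfe]
  refine lintegral_congr fun h => ?_
  rw [roundKernel, Kernel.lintegral_compProd (f := fun z => f (extend (h, z))) _ _ _
    (hfe.comp measurable_prodMk_left)]
  rfl

/-- If the laws of the arms other than `i` agree and the law of arm `i` is dominated by `c` times
that in the second instance, then the likelihood ratio is at most `c ^ pulls i`. -/
theorem lintegral_historyLaw_le {k : ℕ} (π : Policy k) {ν ν' : Fin k → ProbabilityMeasure ℝ}
    {i : Fin k} {c : ENNReal} (hne : ∀ j ≠ i, ν j = ν' j)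
    (hi : (ν i : Measure ℝ) ≤ c • (ν' i : Measure ℝ)) (n : ℕ)
    {f : History k n → ENNReal} (hf : Measurable f) :
    ∫⁻ h, f h ∂historyLaw π ν n ≤ ∫⁻ h, f h * c ^ pulls i h ∂historyLaw π ν' n := by
  have hpow : ∀ m, Measurable fun h : History k m => c ^ pulls i h := fun m =>
    (measurable_from_nat (f := fun t : ℕ => c ^ t)).comp (measurable_pulls i)
  induction n with
  | zero => simp [historyLaw, pulls]
  | succ n ih =>
    have hg : ∀ h a, Measurable fun x : ℝ => f (extend (h, (a, x))) := fun h a =>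
      hf.comp (measurable_extend.comp (measurable_prodMk_left.comp measurable_prodMk_left))
    have hstep : ∀ (h : History k n) (a : Fin k),
        ∫⁻ x, f (extend (h, (a, x))) ∂(ν a : Measure ℝ) ≤
          c ^ (if a = i then 1 else 0) * ∫⁻ x, f (extend (h, (a, x))) ∂(ν' a : Measure ℝ) := by
      intro h a
      split_ifs with ha
      · subst ha
        rw [pow_one, ← smul_eq_mul, ← lintegral_smul_measure]
        exact lintegral_mono' hi le_rfl
      · rw [pow_zero, one_mul, hne a ha]
    have hF : Measurable fun h : History k n => ∫⁻ a, c ^ (if a = i then 1 else 0) *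
        ∫⁻ x, f (extend (h, (a, x))) ∂(ν' a : Measure ℝ) ∂π.next n h := by
      refine Measurable.lintegral_kernel_prod_right' (κ := π.next n)
        (f := fun p : History k n × Fin k => c ^ (if p.2 = i then 1 else 0) *
          ∫⁻ x, f (extend (p.1, (p.2, x))) ∂(ν' p.2 : Measure ℝ)) ?_
      refine ((measurable_of_countable fun a : Fin k =>
        c ^ (if a = i then 1 else 0)).comp measurable_snd).mul ?_
      exact Measurable.lintegral_kernel_prod_right'
        (κ := Kernel.prodMkLeft (History k n) (rewardKernel ν'))
        (f := fun q : (History k n × Fin k) × ℝ => f (extend (q.1.1, (q.1.2, q.2))))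
        (hf.comp (measurable_extend.comp (by fun_prop)))
    rw [lintegral_historyLaw_succ π ν n hf,
      lintegral_historyLaw_succ π ν' n (f := fun h => f h * c ^ pulls i h) (hf.mul (hpow _))]
    -- The policy kernel is common to both instances, so only the last reward law is exchanged, for
    -- a factor `c` if arm `i` was drawn. The induction hypothesis, applied to the resulting
    -- function of the first `n` rounds, exchanges the rest.
    calc _ ≤ ∫⁻ h, ∫⁻ a, c ^ (if a = i then 1 else 0) *
            ∫⁻ x, f (extend (h, (a, x))) ∂(ν' a : Measure ℝ) ∂π.next n h ∂historyLaw π ν n :=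
          lintegral_mono fun h => lintegral_mono fun a => hstep h a
      _ ≤ _ := ih hF
      _ = _ := by
        refine lintegral_congr fun h => ?_
        rw [← lintegral_mul_const _ (measurable_of_countable _)]
        refine lintegral_congr fun a => ?_
        rw [mul_right_comm, mul_comm, ← pow_add, add_comm, ← lintegral_mul_const _ (hg h a)]
        exact lintegral_congr fun x => by rw [pulls_extend]

theorem measureReal_pulls_le_le {k : ℕ} (π : Policy k) {ν ν' : Fin k → ProbabilityMeasure ℝ}
    {i : Fin k} {δ : ℝ} (hδ : 0 ≤ δ) (hne : ∀ j ≠ i, ν j = ν' j)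
    (hi : (ν i : Measure ℝ) ≤ ENNReal.ofReal (Real.exp δ) • (ν' i : Measure ℝ)) (n : ℕ) (m : ℝ) :
    (historyLaw π ν n).real {h | (pulls i h : ℝ) ≤ m} ≤
      Real.exp (δ * m) * (historyLaw π ν' n).real {h | (pulls i h : ℝ) ≤ m} := by
  have hmeas : MeasurableSet {h : History k n | (pulls i h : ℝ) ≤ m} :=
    measurableSet_le (measurable_from_nat.comp (measurable_pulls i)) measurable_const
  have key : historyLaw π ν n {h | (pulls i h : ℝ) ≤ m} ≤
      ENNReal.ofReal (Real.exp (δ * m)) * historyLaw π ν' n {h | (pulls i h : ℝ) ≤ m} := by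
    rw [← lintegral_indicator_one hmeas, ← lintegral_indicator_one hmeas,
      ← lintegral_const_mul' _ _ ENNReal.ofReal_ne_top]
    refine (lintegral_historyLaw_le π hne hi n (measurable_one.indicator hmeas)).trans
      (lintegral_mono fun h => ?_)
    by_cases hh : h ∈ {h : History k n | (pulls i h : ℝ) ≤ m}
    · simp only [Set.indicator_of_mem hh, Pi.one_apply, one_mul, mul_one]
      rw [← ENNReal.ofReal_pow (Real.exp_pos _).le, ← Real.exp_nat_mul, mul_comm]
      exact ENNReal.ofReal_le_ofReal (Real.exp_le_exp.2 (mul_le_mul_of_nonneg_left hh hδ))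
    · simp [Set.indicator_of_notMem hh]
  have := ENNReal.toReal_mono (ENNReal.mul_ne_top ENNReal.ofReal_ne_top (measure_ne_top _ _)) key
  rwa [ENNReal.toReal_mul, ENNReal.toReal_ofReal (Real.exp_pos _).le] at this

/-! ### The regret lower bound -/

theorem exists_perturbation {k : ℕ} {M : Set (ProbabilityMeasure ℝ)}
    (hint : ∀ F ∈ M, Integrable (fun x => x) (F : Measure ℝ))
    (hmix : ∀ F ∈ M, ∀ p, ∀ hp : p ∈ Set.Icc (0 : ℝ) 1, ∀ y, mixDirac F p hp y ∈ M)
    {ν : Fin k → ProbabilityMeasure ℝ} (hν : ∀ j, ν j ∈ M) (i : Fin k) {δ : ℝ} (hδ : 0 < δ) :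
    ∃ ν' : Fin k → ProbabilityMeasure ℝ, (∀ j, ν' j ∈ M) ∧ (∀ j ≠ i, ν j = ν' j) ∧
      (ν i : Measure ℝ) ≤ ENNReal.ofReal (Real.exp δ) • (ν' i : Measure ℝ) ∧
      ∀ j ≠ i, 1 ≤ gap ν' j := by
  -- Chosen so that `exp δ * (1 - p) = 1`.
  set p : ℝ := 1 - Real.exp (-δ) with hpdef
  have hp₀ : 0 < p := sub_pos.2 (Real.exp_lt_one_iff.2 (by linarith))
  have hp : p ∈ Set.Icc (0 : ℝ) 1 := ⟨hp₀.le, by linarith [Real.exp_pos (-δ)]⟩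
  set s : ℝ := ⨆ j, mean (ν j) with hs
  -- Solves `(1 - p) * mean (ν i) + p * y = s + 1`.
  set y : ℝ := (s + 1 - (1 - p) * mean (ν i)) / p with hy
  have hne : ∀ j ≠ i, ν j = Function.update ν i (mixDirac (ν i) p hp y) j :=
    fun j hj => (Function.update_of_ne hj _ _).symm
  refine ⟨Function.update ν i (mixDirac (ν i) p hp y), fun j => ?_, hne, ?_, fun j hj => ?_⟩
  · rcases eq_or_ne j i with rfl | hj
    · rw [Function.update_self]
      exact hmix _ (hν j) _ _ _
    · rw [← hne j hj]
      exact hν j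
  · rw [Function.update_self]
    refine le_smul_mixDirac _ _ _ _ _ ?_
    rw [hpdef, sub_sub_cancel, ← Real.exp_add, add_neg_cancel, Real.exp_zero]
  · have h₁ := mean_le_iSup (Function.update ν i (mixDirac (ν i) p hp y)) i
    rw [Function.update_self, mean_mixDirac hp y (hint _ (hν i)), hy,
      mul_div_cancel₀ _ hp₀.ne'] at h₁
    have h₂ := mean_le_iSup ν j
    rw [gap, ← hne j hj]
    linarith

/-- Only integrability and closure under mixing matter, so one argument covers all four classes. -/
theorem tendsto_regret_div_log {k : ℕ} {M : Set (ProbabilityMeasure ℝ)}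
    (hint : ∀ F ∈ M, Integrable (fun x => x) (F : Measure ℝ))
    (hmix : ∀ F ∈ M, ∀ p, ∀ hp : p ∈ Set.Icc (0 : ℝ) 1, ∀ y, mixDirac F p hp y ∈ M)
    {π : Policy k} (hπ : Consistent M π) {ν : Fin k → ProbabilityMeasure ℝ}
    (hν : ∀ j, ν j ∈ M) {i : Fin k} (hi : 0 < gap ν i) :
    Tendsto (fun n : ℕ => regret π ν n / Real.log n) atTop atTop := by
  refine tendsto_atTop.2 fun K₀ => ?_
  set K : ℝ := max K₀ 1
  have hK : 0 < K := lt_of_lt_of_le one_pos (le_max_right _ _)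
  set B : ℝ := 2 * K / gap ν i with hB
  have hBpos : 0 < B := by positivity
  -- Makes `exp (δ * (B * log n))` equal to `n ^ (1 / 4)`; it is independent of `n`, so a single
  -- `ν'` serves all large `n`.
  set δ : ℝ := 1 / (4 * B) with hδdef
  have hδ : 0 < δ := by positivity
  obtain ⟨ν', hν', hne, hle, hgap⟩ := exists_perturbation hint hmix hν i hδ
  -- The exponent is `1 - 1 / 4`, and `1 / 8` lies below the constant `1 / 4` of the lower bound
  -- `hlow`.
  have hcons := (hπ ν' hν' (3 / 4) (by norm_num)).bound (show (0 : ℝ) < 1 / 8 by norm_num)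
  -- Gives `B * log n ≤ n / 2`, leaving at least half of the rounds to the other arms.
  have hlog := (Real.isLittleO_log_id_atTop.comp_tendsto
    tendsto_natCast_atTop_atTop).bound (show (0 : ℝ) < 1 / (2 * B) by positivity)
  filter_upwards [hcons, hlog, eventually_ge_atTop 2] with n hn hln hn2
  have hn2' : (2 : ℝ) ≤ n := by exact_mod_cast hn2
  have hn0 : (0 : ℝ) < n := by linarith
  have hlpos : 0 < Real.log n := Real.log_pos (by linarith)
  by_contra! hlt
  have hreg : regret π ν n ≤ K * Real.log n :=
    ((div_lt_iff₀ hlpos).1 (hlt.trans_le (le_max_left K₀ 1))).le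
  have hpulls : 2 * expectedPulls π ν i n ≤ B * Real.log n := by
    have h := (gap_mul_expectedPulls_le_regret π ν i n).trans hreg
    rw [hB, div_mul_eq_mul_div, le_div_iff₀ hi]
    linarith
  have h₁ := half_le_measureReal_pulls_le π ν i n (mul_pos hBpos hlpos) hpulls
  have h₂ := measureReal_pulls_le_le π hδ.le hne hle n (B * Real.log n)
  have h₃ := (mul_measureReal_le_sub_expectedPulls π ν' i n (B * Real.log n)).trans
    (sub_expectedPulls_le_regret π ν' i hgap n)
  set q := (historyLaw π ν' n).real {h | (pulls i h : ℝ) ≤ B * Real.log n}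
  have hexp : Real.exp (δ * (B * Real.log n)) = (n : ℝ) ^ (1 / 4 : ℝ) := by
    rw [Real.rpow_def_of_pos hn0, hδdef]
    congr 1
    field_simp
  rw [hexp] at h₂
  have hhalf : B * Real.log n ≤ n / 2 := by
    simp only [Function.comp_apply, id_eq, Real.norm_of_nonneg hlpos.le,
      Real.norm_of_nonneg hn0.le] at hln
    calc B * Real.log n ≤ B * (1 / (2 * B) * n) := by gcongr
      _ = n / 2 := by field_simp
  have hsplit : (n : ℝ) = (n : ℝ) ^ (3 / 4 : ℝ) * (n : ℝ) ^ (1 / 4 : ℝ) := by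
    rw [← Real.rpow_add hn0]
    norm_num
  have hpos : 0 < (n : ℝ) ^ (3 / 4 : ℝ) := Real.rpow_pos_of_pos hn0 _
  have hq : 0 ≤ q := measureReal_nonneg
  have hlow : (n : ℝ) ^ (3 / 4 : ℝ) / 4 ≤ regret π ν' n :=
    calc (n : ℝ) ^ (3 / 4 : ℝ) / 4 = (n : ℝ) ^ (3 / 4 : ℝ) / 2 * (1 / 2) := by ring
      _ ≤ (n : ℝ) ^ (3 / 4 : ℝ) / 2 * ((n : ℝ) ^ (1 / 4 : ℝ) * q) := by
          gcongr
          exact h₁.trans h₂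
      _ = n / 2 * q := by
          conv_rhs => rw [hsplit]
          ring
      _ ≤ (n - B * Real.log n) * q := by
          gcongr
          linarith
      _ ≤ _ := h₃
  rw [Real.norm_of_nonneg hpos.le] at hn
  linarith [(Real.le_norm_self _).trans hn]

end Bandit

theorem theorem1 (k : ℕ) (M : Set (ProbabilityMeasure ℝ))
    (hM : M = Bandit.bounded ∨ M = Bandit.subGaussian ∨ M = Bandit.subExponential ∨
      M = Bandit.finiteMoment)
    (π : Bandit.Policy k) (hπ : Bandit.Consistent M π)
    (ν : Fin k → ProbabilityMeasure ℝ) (hν : ∀ i, ν i ∈ M)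
    (hsub : ∃ i, 0 < Bandit.gap ν i) :
    Tendsto (fun n : ℕ => Bandit.regret π ν n / Real.log n) atTop atTop := by

  obtain ⟨i, hi⟩ := hsub
  rcases hM with rfl | rfl | rfl | rfl
  · exact Bandit.tendsto_regret_div_log (fun _ h => Bandit.integrable_id_of_mem_bounded h)
      (fun _ h _ hp y => Bandit.mixDirac_mem_bounded h hp y) hπ hν hi
  · exact Bandit.tendsto_regret_div_log (fun _ h => Bandit.integrable_id_of_mem_subGaussian h)
      (fun _ h _ hp y => Bandit.mixDirac_mem_subGaussian h hp y) hπ hν hi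
  · exact Bandit.tendsto_regret_div_log (fun _ h => Bandit.integrable_id_of_mem_subExponential h)
      (fun _ h _ hp y => Bandit.mixDirac_mem_subExponential h hp y) hπ hν hi
  · exact Bandit.tendsto_regret_div_log (fun _ h => Bandit.integrable_id_of_mem_finiteMoment h)
      (fun _ h _ hp y => Bandit.mixDirac_mem_finiteMoment h hp y) hπ hν hi
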